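/- Let $X$ be a real locally convex topological vector space (not necessarily Hausdorff), let $C\subseteq X$ be a nonempty convex set with closure $\overline{C}$, and let $f\colon C\to\overline{C}$ be a sequentially continuous map (that is, $x_n\to x$ in $C$ implies $f(x_n)\to f(x)$) such that $f(C)$ is totally bounded (that is, for every neighbourhood $U$ of $0$ the set $f(C)$ is covered by finitely many translates of $U$). Then $f$ has an approximate fixed point net: there is a net $(x_i)_{i\in I}$ in $C$, indexed by a nonempty directed set $I$, with $x_i-f(x_i)\to 0$; equivalently, $$0\in\overline{\{x-f(x) : x\in C\}}.$$ -/

import Mathlib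

open Filter Topology

universe u

/-- A map `f : C → closure C` has an approximate fixed point net if there is a net `(xᵢ)` in `C`,
indexed by a nonempty directed (preordered) set, such that `xᵢ - f xᵢ → 0`. -/
def HasApproxFixedPointNet {X : Type u} [AddCommGroup X] [TopologicalSpace X]
    {C : Set X} (f : C → closure C) : Prop :=
  ∃ (ι : Type u) (_ : Preorder ι) (_ : IsDirectedOrder ι) (_ : Nonempty ι) (x : ι → C),
    Tendsto (fun i => (x i : X) - (f (x i) : X)) atTop (𝓝 0)

/-! A combinatorial parity argument (Scarf) gives Brouwer's theorem on a simplex, and Schauder's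
approximation transfers it to `C`. By total boundedness, finitely many unit balls of a continuous
seminorm `p`, with centres moved into `C`, cover `f(C)`. The simplex of weights on the centres maps
into `C` by taking weighted averages; it is metrizable, so `f` composed with this map is continuous.
Reweighting the centres by their closeness to the value of `f` is then a continuous self-map of the
simplex. At a fixed point (`exists_fixedPoint_stdSimplex`) the point of `C` is an average of centres
`p`-close to its image, hence `p`-close to it as balls are convex. Local convexity turns seminorm
estimates into neighbourhoods of `0`. -/

/-- A finite set `P` is dominant for the orders induced by the `v i` if no point lies strictly
above the minimum of `P` in all of these orders simultaneously. -/
def Dominant {ι E β : Type*} [LE β] (v : ι → E → β) (P : Finset E) : Prop :=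
  ∀ y, ∃ i, ∀ x ∈ P, v i y ≤ v i x

/-! ### Scarf's lemma by double counting. -/

section Scarf

variable {ι E β : Type*} [Fintype ι] [DecidableEq ι] [Fintype E] [DecidableEq E] [LinearOrder β]

/-- Exchange property: in a dominant set with one element less than there are orders, in which
the orders `a` and `b` have the same minimum, there is a unique way to add an element that
becomes the new minimum of the order `a`. -/
lemma Dominant.exists_unique_insert {v : ι → E → β} (hv : ∀ i, Function.Injective (v i))
    {Q : Finset E} (hQ : Dominant v Q) {m : ι → E}
    (hm : ∀ i, m i ∈ Q ∧ ∀ x ∈ Q, v i (m i) ≤ v i x) {a b : ι} (hab : a ≠ b) (hmab : m a = m b)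
    (hne : ∃ y, ∀ i, i ≠ a → v i (m i) < v i y) :
    ∃ x, x ∉ Q ∧ Dominant v (insert x Q) ∧ (∀ i, i ≠ a → v i (m i) < v i x) ∧
      ∀ z, Dominant v (insert z Q) → (∀ i, i ≠ a → v i (m i) < v i z) → z = x := by
  classical
  obtain ⟨y, hy⟩ := hne
  -- The new point is the `a`-largest among those exceeding the minima of all other orders; only the
  -- order `a` can witness dominance at such points.
  obtain ⟨x, hx, hmax⟩ := Finset.exists_max_image
    (Finset.univ.filter fun y => ∀ i, i ≠ a → v i (m i) < v i y) (v a) ⟨y, by simpa using hy⟩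
  simp only [Finset.mem_filter, Finset.mem_univ, true_and] at hx hmax
  have lt_a : ∀ z, (∀ i, i ≠ a → v i (m i) < v i z) → v a z ≤ v a (m a) := by
    intro z hz
    obtain ⟨i, hi⟩ := hQ z
    by_cases hia : i = a
    · subst hia; exact hi _ (hm i).1
    · exact absurd (hi _ (hm i).1) (not_le.2 (hz i hia))
  have hxQ : x ∉ Q := by
    intro hxQ
    obtain ⟨i, hi⟩ := hQ x
    by_cases hia : i = a
    · subst hia
      have : x = m i := hv i (le_antisymm (hi _ (hm i).1) ((hm i).2 _ hxQ))
      have h2 := hx b hab.symm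
      rw [this, hmab] at h2
      exact lt_irrefl _ h2
    · exact absurd (hi _ (hm i).1) (not_le.2 (hx i hia))
  refine ⟨x, hxQ, ?_, hx, ?_⟩
  · intro y
    by_cases h : ∀ i, i ≠ a → v i (m i) < v i y
    · refine ⟨a, fun z hz => ?_⟩
      rcases Finset.mem_insert.1 hz with rfl | hz
      · exact hmax y h
      · exact (lt_a y h).trans ((hm a).2 z hz)
    · push Not at h
      obtain ⟨i, hia, hi⟩ := h
      refine ⟨i, fun z hz => ?_⟩
      rcases Finset.mem_insert.1 hz with rfl | hz
      · exact hi.trans (hx i hia).le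
      · exact hi.trans ((hm i).2 z hz)
  · intro z hz hz'
    obtain ⟨i, hi⟩ := hz x
    by_cases hia : i = a
    · subst hia
      exact hv i (le_antisymm (hmax z hz') (hi z (Finset.mem_insert_self _ _)))
    · exact absurd (hi _ (Finset.mem_insert_of_mem (hm i).1)) (not_le.2 (hx i hia))

/-- A nonempty dominant set with one element less than there are orders extends in exactly two
ways to a dominant set with one more element, as soon as no order obstructs the exchange. -/
lemma Dominant.exists_two_insert {v : ι → E → β} (hv : ∀ i, Function.Injective (v i))
    {Q : Finset E} (hQ : Dominant v Q) (hQne : Q.Nonempty) (hcard : Q.card + 1 = Fintype.card ι)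
    (hex : ∀ a, ∃ y, ∀ i, i ≠ a → ∃ x ∈ Q, v i x < v i y) :
    ∃ x y, x ≠ y ∧ x ∉ Q ∧ y ∉ Q ∧ Dominant v (insert x Q) ∧ Dominant v (insert y Q) ∧
      ∀ z, z ∉ Q → Dominant v (insert z Q) → z = x ∨ z = y := by
  classical
  have hm : ∀ i, ∃ m, m ∈ Q ∧ ∀ x ∈ Q, v i m ≤ v i x := fun i =>
    Finset.exists_min_image Q (v i) hQne
  choose m hm using hm
  -- There is one order more than elements of `Q`, and by dominance each element is the minimum of
  -- some order (`hsurj`), so exactly one pair of orders shares its minimum.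
  obtain ⟨a, -, b, -, hab, hmab⟩ := Finset.exists_ne_map_eq_of_card_lt_of_maps_to
    (s := (Finset.univ : Finset ι)) (t := Q) (f := m) (by rw [Finset.card_univ]; omega)
    (fun i _ => (hm i).1)
  have hsurj : Finset.univ.image m = Q := by
    ext x
    simp only [Finset.mem_image, Finset.mem_univ, true_and]
    refine ⟨?_, fun hx => ?_⟩
    · rintro ⟨i, rfl⟩; exact (hm i).1
    · obtain ⟨i, hi⟩ := hQ x
      exact ⟨i, hv i (le_antisymm ((hm i).2 x hx) (hi _ (hm i).1))⟩
  have hinj : ∀ a b, a ≠ b → m a = m b → ∀ i j, i ≠ a → j ≠ a → m i = m j → i = j := by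
    intro a b hab hmab i j hi hj hij
    have himg : (Finset.univ.erase a).image m = Q := by
      rw [← hsurj]
      refine Finset.Subset.antisymm (Finset.image_subset_image (Finset.erase_subset _ _)) ?_
      intro x hx
      obtain ⟨k, -, rfl⟩ := Finset.mem_image.1 hx
      by_cases hk : k = a
      · exact Finset.mem_image.2 ⟨b, by simp [hab.symm], by rw [hk, hmab]⟩
      · exact Finset.mem_image_of_mem _ (by simp [hk])
    have hinjOn : Set.InjOn m (Finset.univ.erase a : Finset ι) := by
      apply Finset.card_image_iff.1
      rw [himg, Finset.card_erase_of_mem (Finset.mem_univ _), Finset.card_univ]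
      omega
    exact hinjOn (by simp [hi]) (by simp [hj]) hij
  have hgt : ∀ a, ∃ y, ∀ i, i ≠ a → v i (m i) < v i y := fun a => by
    obtain ⟨y, hy⟩ := hex a
    refine ⟨y, fun i hi => ?_⟩
    obtain ⟨x, hx, hxy⟩ := hy i hi
    exact ((hm i).2 x hx).trans_lt hxy
  obtain ⟨x, hxQ, hxD, hx, hxu⟩ := hQ.exists_unique_insert hv hm hab hmab (hgt a)
  obtain ⟨y, hyQ, hyD, hy, hyu⟩ := hQ.exists_unique_insert hv hm hab.symm hmab.symm (hgt b)
  -- Minima of orders other than `a` are distinct, so dominance at `m j` can only be witnessed by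
  -- `j`, which keeps `z` above `m j`.
  have key : ∀ a b, a ≠ b → m a = m b → ∀ z, Dominant v (insert z Q) →
      v a z < v a (m a) → ∀ j, j ≠ a → z ∉ Q → v j (m j) < v j z := by
    intro a b hab hmab z hz hza j hja hzQ
    by_contra hcon
    obtain ⟨l, hl⟩ := hz (m j)
    have hjl : m j = m l := hv l (le_antisymm (hl _ (Finset.mem_insert_of_mem (hm l).1))
      ((hm l).2 _ (hm j).1))
    have hlz := hl z (Finset.mem_insert_self _ _)
    have hla : l ≠ a := by
      rintro rfl
      rw [hjl] at hlz
      exact absurd hlz (not_le.2 hza)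
    obtain rfl := hinj a b hab hmab j l hja hla hjl
    have : m j = z := hv j (le_antisymm hlz (not_lt.1 hcon))
    exact hzQ (this ▸ (hm j).1)
  refine ⟨x, y, ?_, hxQ, hyQ, hxD, hyD, ?_⟩
  · rintro rfl
    obtain ⟨i, hi⟩ := hQ x
    refine absurd (hi _ (hm i).1) (not_le.2 ?_)
    by_cases hia : i = a
    · exact hy i (hia ▸ hab)
    · exact hx i hia
  · intro z hzQ hz
    obtain ⟨i, hi⟩ := hz z
    have hlt : v i z < v i (m i) := lt_of_le_of_ne (hi _ (Finset.mem_insert_of_mem (hm i).1))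
      fun h => hzQ (hv i h ▸ (hm i).1)
    -- Once `z` undercuts `m i` in the order `i`, another order must have the minimum `m i`, so `i`
    -- belongs to the colliding pair.
    have hiab : i = a ∨ i = b := by
      by_contra! hcon
      obtain ⟨l, hl⟩ := hz (m i)
      have hil : m i = m l := hv l (le_antisymm (hl _ (Finset.mem_insert_of_mem (hm l).1))
        ((hm l).2 _ (hm i).1))
      have hli : l ≠ i := by
        rintro rfl
        exact absurd (hl z (Finset.mem_insert_self _ _)) (not_le.2 hlt)
      have hla : l = a := by
        by_contra h
        exact hli (hinj a b hab hmab i l hcon.1 h hil).symm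
      have hlb : l = b := by
        by_contra h
        exact hli (hinj b a hab.symm hmab.symm i l hcon.2 h hil).symm
      exact hab (hla.symm.trans hlb)
    rcases hiab with rfl | rfl
    · exact Or.inl (hxu z hz fun j hj => key i b hab hmab z hz hlt j hj hzQ)
    · exact Or.inr (hyu z hz fun j hj => key i a hab.symm hmab.symm z hz hlt j hj hzQ)

/-- A set of `card ι` points that misses a colour has an even number of facets coloured by
exactly the colours different from `i₀`. -/
lemma even_card_facets (c : E → ι) (i₀ : ι) {P : Finset E} (hP : P.card = Fintype.card ι)
    (hc : P.image c ≠ Finset.univ) :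
    Even (Finset.univ.filter fun Q : Finset E =>
      Q ⊆ P ∧ Q.card + 1 = Fintype.card ι ∧ Q.image c = Finset.univ.erase i₀).card := by
  classical
  rcases Finset.eq_empty_or_nonempty (Finset.univ.filter fun Q : Finset E =>
      Q ⊆ P ∧ Q.card + 1 = Fintype.card ι ∧ Q.image c = Finset.univ.erase i₀) with h | ⟨Q, hQ⟩
  · simp [h]
  simp only [Finset.mem_filter, Finset.mem_univ, true_and] at hQ
  obtain ⟨hQP, hQc, hQi⟩ := hQ
  have facet : ∀ R : Finset E, R ⊆ P → R.card + 1 = Fintype.card ι →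
      ∃ x, x ∉ R ∧ insert x R = P := by
    intro R hR hRc
    exact Finset.covBy_iff_exists_insert.1
      (Finset.covBy_iff_card_sdiff_eq_one.2 ⟨hR, by rw [Finset.card_sdiff_of_subset hR]; omega⟩)
  have inj : ∀ R : Finset E, R.card + 1 = Fintype.card ι → R.image c = Finset.univ.erase i₀ →
      Set.InjOn c R := by
    intro R hRc hRi
    apply Finset.card_image_iff.1
    rw [hRi, Finset.card_erase_of_mem (Finset.mem_univ _), Finset.card_univ]
    omega
  obtain ⟨x, hxQ, rfl⟩ := facet Q hQP hQc
  have hxi : c x ≠ i₀ := by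
    intro h
    apply hc
    rw [Finset.image_insert, hQi, h, Finset.insert_erase (Finset.mem_univ _)]
  -- The extra point repeats the colour of a unique `y` in `Q`; removing either twin gives the two
  -- facets.
  obtain ⟨y, hyQ, hyx⟩ : ∃ y ∈ Q, c y = c x := by
    have : c x ∈ Q.image c := by rw [hQi]; simp [hxi]
    simpa using this
  have hxy : x ≠ y := fun h => hxQ (h ▸ hyQ)
  suffices h : (Finset.univ.filter fun R : Finset E =>
      R ⊆ insert x Q ∧ R.card + 1 = Fintype.card ι ∧ R.image c = Finset.univ.erase i₀) =
      {Q, insert x (Q.erase y)} by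
    rw [h, Finset.card_pair]
    · exact even_two
    · intro h
      exact hxQ (h ▸ Finset.mem_insert_self _ _)
  ext R
  simp only [Finset.mem_filter, Finset.mem_univ, true_and, Finset.mem_insert,
    Finset.mem_singleton]
  constructor
  · rintro ⟨hR, hRc, hRi⟩
    obtain ⟨z, hzR, hz⟩ := facet R hR hRc
    have hRz : R = (insert x Q).erase z := by rw [← hz, Finset.erase_insert hzR]
    by_cases hzx : z = x
    · left
      rw [hRz, hzx, Finset.erase_insert hxQ]
    by_cases hzy : z = y
    · right
      rw [hRz, hzy, Finset.erase_insert_of_ne hxy]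
    · exfalso
      refine hxy (inj R hRc hRi ?_ ?_ hyx.symm)
      · rw [hRz]; simp [Ne.symm hzx]
      · rw [hRz]; simp [Ne.symm hzy, hyQ]
  · rintro (rfl | rfl)
    · exact ⟨hQP, hQc, hQi⟩
    · refine ⟨Finset.insert_subset_insert _ (Finset.erase_subset _ _), ?_, ?_⟩
      · rw [Finset.card_insert_of_notMem (by simp [hxQ]), Finset.card_erase_add_one hyQ, hQc]
      · rw [Finset.image_insert, ← hyx, ← Finset.image_insert, Finset.insert_erase hyQ, hQi]

/-- **Scarf's lemma**: given finitely many linear orders on a finite set and, for each order `i`,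
a slack point `e i` of colour `i` that is the minimum of the order `i` and lies above all ordinary
points in the other orders, there is a dominant set carrying all colours. -/
theorem exists_dominant_image_eq_univ {v : ι → E → β} (hv : ∀ i, Function.Injective (v i))
    (e : ι → E) (hbot : ∀ i y, v i (e i) ≤ v i y)
    (htop : ∀ i j y, j ≠ i → y ∉ Set.range e → v i y < v i (e j))
    (hne : ∃ y, y ∉ Set.range e) (c : E → ι) (hc : ∀ i, c (e i) = i) [Nonempty ι] :
    ∃ P : Finset E, Dominant v P ∧ P.image c = Finset.univ := by
  classical
  by_contra! hcon
  obtain ⟨i₀⟩ := ‹Nonempty ι›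
  have he : Function.Injective e := fun i j h => by rw [← hc i, ← hc j, h]
  -- Incidences between doors and rooms are counted twice. Without a fully coloured room each room
  -- has evenly many doors, while `Q₀` is the only door lying in an odd number of rooms, namely one.
  let rooms : Finset (Finset E) :=
    Finset.univ.filter fun P => Dominant v P ∧ P.card = Fintype.card ι
  let doors : Finset (Finset E) := Finset.univ.filter fun Q =>
    Dominant v Q ∧ Q.card + 1 = Fintype.card ι ∧ Q.image c = Finset.univ.erase i₀
  let Q₀ : Finset E := (Finset.univ.erase i₀).image e
  have hcount := Finset.sum_card_bipartiteAbove_eq_sum_card_bipartiteBelow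
    (s := doors) (t := rooms) (fun Q P => Q ⊆ P)
  have hrooms : Even (∑ P ∈ rooms, (Finset.bipartiteBelow (fun Q P => Q ⊆ P) doors P).card) := by
    refine Finset.even_sum _ fun P hP => ?_
    simp only [rooms, Finset.mem_filter, Finset.mem_univ, true_and] at hP
    suffices h : Finset.bipartiteBelow (fun Q P => Q ⊆ P) doors P =
        Finset.univ.filter fun Q : Finset E =>
          Q ⊆ P ∧ Q.card + 1 = Fintype.card ι ∧ Q.image c = Finset.univ.erase i₀ by
      rw [h]
      exact even_card_facets c i₀ hP.2 (hcon P hP.1)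
    ext Q
    simp only [Finset.mem_bipartiteBelow, doors, Finset.mem_filter, Finset.mem_univ, true_and]
    refine ⟨fun h => ⟨h.2, h.1.2⟩, fun h => ⟨⟨fun y => ?_, h.2⟩, h.1⟩⟩
    obtain ⟨i, hi⟩ := hP.1 y
    exact ⟨i, fun x hx => hi x (h.1 hx)⟩
  have habove : ∀ Q : Finset E, Q.card + 1 = Fintype.card ι → ∀ P,
      P ∈ Finset.bipartiteAbove (fun Q P => Q ⊆ P) rooms Q ↔
        ∃ x, x ∉ Q ∧ Dominant v (insert x Q) ∧ insert x Q = P := by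
    intro Q hQ P
    simp only [Finset.mem_bipartiteAbove, rooms, Finset.mem_filter, Finset.mem_univ, true_and]
    constructor
    · rintro ⟨⟨hP, hPc⟩, hQP⟩
      obtain ⟨x, hx, rfl⟩ := Finset.covBy_iff_exists_insert.1
        (Finset.covBy_iff_card_sdiff_eq_one.2
          ⟨hQP, by rw [Finset.card_sdiff_of_subset hQP]; omega⟩)
      exact ⟨x, hx, hP, rfl⟩
    · rintro ⟨x, hx, hD, rfl⟩
      exact ⟨⟨hD, by rw [Finset.card_insert_of_notMem hx, hQ]⟩, Finset.subset_insert _ _⟩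
  have hdoors : ∀ Q ∈ doors, Q ≠ Q₀ →
      Even (Finset.bipartiteAbove (fun Q P => Q ⊆ P) rooms Q).card := by
    intro Q hQ hQ0
    simp only [doors, Finset.mem_filter, Finset.mem_univ, true_and] at hQ
    obtain ⟨hD, hQc, hQi⟩ := hQ
    -- A door made of slack points only is forced by its colours to be `Q₀`; an ordinary point makes
    -- the exchange possible, since `e a` exceeds it in every order but `a`.
    obtain ⟨y, hyQ, hy⟩ : ∃ y ∈ Q, y ∉ Set.range e := by
      by_contra! hall
      apply hQ0
      refine Finset.eq_of_subset_of_card_le ?_ ?_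
      · intro x hx
        obtain ⟨i, rfl⟩ := hall x hx
        have : c (e i) ∈ Finset.univ.erase i₀ := hQi ▸ Finset.mem_image_of_mem c hx
        rw [hc] at this
        exact Finset.mem_image_of_mem e this
      · rw [Finset.card_image_of_injective _ he, Finset.card_erase_of_mem (Finset.mem_univ _),
          Finset.card_univ]
        omega
    obtain ⟨x, z, hxz, hx, hz, hxD, hzD, hu⟩ := hD.exists_two_insert hv ⟨y, hyQ⟩ hQc
      fun a => ⟨e a, fun i hi => ⟨y, hyQ, htop i a y hi.symm hy⟩⟩
    have : Finset.bipartiteAbove (fun Q P => Q ⊆ P) rooms Q = {insert x Q, insert z Q} := by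
      ext P
      rw [habove Q hQc, Finset.mem_insert, Finset.mem_singleton]
      constructor
      · rintro ⟨w, hw, hwD, rfl⟩
        rcases hu w hw hwD with rfl | rfl
        · exact Or.inl rfl
        · exact Or.inr rfl
      · rintro (rfl | rfl)
        · exact ⟨x, hx, hxD, rfl⟩
        · exact ⟨z, hz, hzD, rfl⟩
    rw [this, Finset.card_pair]
    · exact even_two
    · intro h
      have : x ∈ insert z Q := h ▸ Finset.mem_insert_self x Q
      rcases Finset.mem_insert.1 this with h | h
      · exact hxz h
      · exact hx h
  have hQ₀c : Q₀.card + 1 = Fintype.card ι := by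
    rw [Finset.card_image_of_injective _ he, Finset.card_erase_add_one (Finset.mem_univ _),
      Finset.card_univ]
  have hbot' : ∀ i y, v i y ≤ v i (e i) → y = e i := fun i y h =>
    hv i (le_antisymm h (hbot i y))
  have hmemQ₀ : ∀ y, y ∉ Q₀ ↔ ∀ i, i ≠ i₀ → y ≠ e i := by
    intro y
    simp only [Q₀, Finset.mem_image, Finset.mem_erase, Finset.mem_univ, and_true]
    push Not
    exact ⟨fun h i hi hy => h i hi hy.symm, fun h i hi hy => h i hi hy.symm⟩
  obtain ⟨y₀, hy₀⟩ := hne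
  have hy₀Q : y₀ ∉ Q₀ := (hmemQ₀ y₀).2 fun i _ h => hy₀ ⟨i, h.symm⟩
  -- In the orders `i ≠ i₀` the set `Q₀` contains the global minimum, so only `i₀` can witness
  -- dominance outside `Q₀`: the added point must be the `i₀`-maximum there.
  obtain ⟨x, hx, hmax⟩ := Finset.exists_max_image (Finset.univ.filter fun y => y ∉ Q₀) (v i₀)
    ⟨y₀, by simpa using hy₀Q⟩
  simp only [Finset.mem_filter, Finset.mem_univ, true_and] at hx hmax
  have hxD : Dominant v (insert x Q₀) := by
    intro y
    by_cases hy : y ∈ Q₀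
    · obtain ⟨i, -, rfl⟩ := Finset.mem_image.1 hy
      exact ⟨i, fun z _ => hbot i z⟩
    · refine ⟨i₀, fun z hz => ?_⟩
      rcases Finset.mem_insert.1 hz with rfl | hz
      · exact hmax y hy
      · obtain ⟨i, hi, rfl⟩ := Finset.mem_image.1 hz
        by_cases hyr : y ∈ Set.range e
        · obtain ⟨j, rfl⟩ := hyr
          have : j = i₀ := by
            by_contra hj
            exact (hmemQ₀ _).1 hy j hj rfl
          subst this
          exact hbot _ _
        · exact (htop i₀ i y (Finset.ne_of_mem_erase hi) hyr).le
  have hQ₀ : Q₀ ∈ doors := by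
    simp only [doors, Finset.mem_filter, Finset.mem_univ, true_and]
    refine ⟨fun y => ?_, hQ₀c, ?_⟩
    · obtain ⟨i, hi⟩ := hxD y
      exact ⟨i, fun z hz => hi z (Finset.mem_insert_of_mem hz)⟩
    · rw [Finset.image_image]
      rw [show c ∘ e = id from funext hc, Finset.image_id]
  have hone : (Finset.bipartiteAbove (fun Q P => Q ⊆ P) rooms Q₀).card = 1 := by
    rw [Finset.card_eq_one]
    refine ⟨insert x Q₀, ?_⟩
    ext P
    rw [habove Q₀ hQ₀c, Finset.mem_singleton]
    constructor
    · rintro ⟨z, hz, hzD, rfl⟩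
      obtain ⟨i, hi⟩ := hzD x
      by_cases hii : i = i₀
      · subst hii
        rw [hv i (le_antisymm (hmax z hz) (hi z (Finset.mem_insert_self _ _)))]
      · exact absurd (hbot' i x (hi _ (Finset.mem_insert_of_mem
          (Finset.mem_image_of_mem e (by simp [hii]))))) ((hmemQ₀ x).1 hx i hii)
    · rintro rfl
      exact ⟨x, hx, hxD, rfl⟩
  rw [← hcount, ← Finset.add_sum_erase _ _ hQ₀, hone] at hrooms
  have hrest : Even (∑ Q ∈ doors.erase Q₀,
      (Finset.bipartiteAbove (fun Q P => Q ⊆ P) rooms Q).card) :=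
    Finset.even_sum _ fun Q hQ => hdoors Q (Finset.mem_of_mem_erase hQ) (Finset.ne_of_mem_erase hQ)
  rcases hrooms with ⟨r, hr⟩
  rcases hrest with ⟨s, hs⟩
  omega

end Scarf

/-! ### Brouwer's theorem on the simplex. -/

section Brouwer

variable {ι : Type*} [Fintype ι] [Nonempty ι]

/-- The grid of mesh `1 / k` in the standard simplex, in integer coordinates. -/
abbrev SimplexGrid (ι : Type*) [Fintype ι] [DecidableEq ι] (k : ℕ) : Type _ :=
  {a : ι → ℕ // a ∈ Finset.piAntidiag Finset.univ k}

/-- Integer coordinates of the grid points and of one slack point for each vertex. -/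
def gridCoord [DecidableEq ι] (k : ℕ) :
    SimplexGrid ι k ⊕ ι → ι → ℤ
  | .inl a, i => (a.1 i : ℤ)
  -- Grid coordinates lie in `[0, k]`, so these values are strictly below and strictly above all of
  -- them.
  | .inr j, i => if i = j then -1 else k + 1

/-- Every colouring of the `k`-grid of the standard simplex admits a set `P` of grid points of
diameter at most `card ι` such that each colour `i` occurs in `P` or the `i`-th coordinate is
at most `card ι` on `P`. -/
lemma exists_small_colorful [DecidableEq ι] (k : ℕ)
    (c : SimplexGrid ι k → ι) :
    ∃ P : Set (SimplexGrid ι k), P.Nonempty ∧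
      (∀ a ∈ P, ∀ b ∈ P, ∀ i, a.1 i ≤ b.1 i + Fintype.card ι) ∧
      ∀ i, (∃ a ∈ P, c a = i) ∨ ∀ a ∈ P, a.1 i ≤ Fintype.card ι := by
  classical
  obtain ⟨t, ht⟩ := Countable.exists_injective_nat (SimplexGrid ι k ⊕ ι)
  -- The injection `t` breaks ties between equal coordinates.
  let v : ι → SimplexGrid ι k ⊕ ι → ℤ ×ₗ ℕ := fun i y => toLex (gridCoord k y i, t y)
  have hv : ∀ i, Function.Injective (v i) := fun i x y h => ht (congrArg (fun p => (ofLex p).2) h)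
  have hle : ∀ i x y, v i x ≤ v i y → gridCoord k x i ≤ gridCoord k y i := by
    intro i x y h
    rcases Prod.Lex.toLex_le_toLex.1 h with h | h
    · exact h.le
    · exact h.1.le
  have hlt : ∀ i x y, gridCoord k x i < gridCoord k y i → v i x < v i y := fun i x y h =>
    Prod.Lex.toLex_lt_toLex.2 (Or.inl h)
  have hsum : ∀ a : SimplexGrid ι k, ∑ i, a.1 i = k := fun a => (Finset.mem_piAntidiag.1 a.2).1
  have hak : ∀ (a : SimplexGrid ι k) i, a.1 i ≤ k := fun a i =>
    (Finset.single_le_sum (f := a.1) (fun _ _ => Nat.zero_le _) (Finset.mem_univ i)).trans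
      (hsum a).le
  have mem_grid : ∀ a : ι → ℕ, ∑ i, a i = k → a ∈ Finset.piAntidiag Finset.univ k := fun a ha =>
    Finset.mem_piAntidiag.2 ⟨ha, fun _ _ => Finset.mem_univ _⟩
  obtain ⟨i₁⟩ := ‹Nonempty ι›
  let a₀ : SimplexGrid ι k := ⟨Pi.single i₁ k, mem_grid _ (by simp)⟩
  have : Nonempty ι := ⟨i₁⟩
  obtain ⟨P, hP, hPc⟩ := exists_dominant_image_eq_univ hv (fun i => Sum.inr i)
    (by
      rintro i (a | j)
      · apply le_of_lt; apply hlt; simp only [gridCoord, if_true]; omega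
      · by_cases hij : i = j
        · rw [hij]
        · apply le_of_lt; apply hlt; simp only [gridCoord, if_true, if_neg hij]; omega)
    (by
      rintro i j (a | l) hji hy
      · apply hlt
        have := hak a i
        simp only [gridCoord, if_neg hji.symm]
        omega
      · exact absurd ⟨l, rfl⟩ hy)
    ⟨Sum.inl a₀, by simp⟩ (Sum.elim c id) (fun i => rfl)
  have hdom : ∀ y : SimplexGrid ι k, ∃ i, Sum.inr i ∉ P ∧ ∀ a : SimplexGrid ι k, Sum.inl a ∈ P → y.1 i ≤ a.1 i := by
    intro y
    obtain ⟨i, hi⟩ := hP (Sum.inl y)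
    refine ⟨i, fun h => ?_, fun a ha => ?_⟩
    · have := hle _ _ _ (hi _ h)
      simp only [gridCoord, if_true] at this
      omega
    · have := hle _ _ _ (hi _ ha)
      simpa only [gridCoord, Nat.cast_le] using this
  have hcol : ∀ i, Sum.inr i ∉ P → ∃ a : SimplexGrid ι k, Sum.inl a ∈ P ∧ c a = i := by
    intro i hi
    have : i ∈ P.image (Sum.elim c id) := hPc ▸ Finset.mem_univ i
    obtain ⟨a | j, ha, hai⟩ := Finset.mem_image.1 this
    · exact ⟨a, ha, hai⟩
    · obtain rfl : j = i := hai
      exact absurd ha hi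
  obtain ⟨i₂, hi₂, -⟩ := hdom a₀
  obtain ⟨a₁, ha₁, -⟩ := hcol i₂ hi₂
  have hm : ∀ i, ∃ a : SimplexGrid ι k, Sum.inl a ∈ P ∧ ∀ b : SimplexGrid ι k, Sum.inl b ∈ P → a.1 i ≤ b.1 i := by
    intro i
    obtain ⟨a, ha, hmin⟩ := Finset.exists_min_image
      (Finset.univ.filter fun a : SimplexGrid ι k => Sum.inl a ∈ P) (fun a => a.1 i) ⟨a₁, by simpa using ha₁⟩
    exact ⟨a, by simpa using ha, fun b hb => hmin b (by simpa using hb)⟩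
  choose m hmP hm using hm
  set C : Finset ι := Finset.univ.filter fun i => Sum.inr i ∉ P with hC
  -- Otherwise some grid point would exceed the minimum of `P` in every coordinate of `C`, against
  -- dominance; the surplus `r` is put on coordinate `i₂`.
  have hbig : k < ∑ i ∈ C, ((m i).1 i + 1) := by
    by_contra! hcon
    obtain ⟨r, hr⟩ := Nat.exists_eq_add_of_le hcon
    let y : ι → ℕ := fun i => (if i ∈ C then (m i).1 i + 1 else 0) + (if i = i₂ then r else 0)
    have hy : ∑ i, y i = k := by
      simp only [y, Finset.sum_add_distrib, Finset.sum_ite_mem, Finset.univ_inter,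
        Finset.sum_ite_eq', Finset.mem_univ, if_true]
      rw [Finset.sum_add_distrib] at hr
      exact hr.symm
    obtain ⟨i, hi, hia⟩ := hdom ⟨y, mem_grid y hy⟩
    have h := hia (m i) (hmP i)
    have hiC : i ∈ C := by simpa [hC] using hi
    simp only [y, if_pos hiC] at h
    omega
  -- The coordinates sum to `k`, so their excesses over the minima total less than `C.card`.
  have hbound : ∀ a : SimplexGrid ι k, Sum.inl a ∈ P → ∀ i,
      a.1 i ≤ (if i ∈ C then (m i).1 i else 0) + Fintype.card ι := by
    intro a ha i
    have h1 : ∑ j, (if j ∈ C then (m j).1 j else 0) + C.card > k := by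
      simpa [Finset.sum_add_distrib, Finset.sum_ite_mem] using hbig
    have h2 : C.card ≤ Fintype.card ι := Finset.card_le_univ C
    have hle' : ∀ j, (if j ∈ C then (m j).1 j else 0) ≤ a.1 j := by
      intro j
      split_ifs
      · exact hm j a ha
      · exact Nat.zero_le _
    have h3 := Finset.sum_le_sum (s := Finset.univ.erase i) fun j _ => hle' j
    have h4 := Finset.add_sum_erase Finset.univ a.1 (Finset.mem_univ i)
    have h5 := Finset.add_sum_erase Finset.univ (fun j => if j ∈ C then (m j).1 j else 0)
      (Finset.mem_univ i)
    have h6 := hsum a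
    omega
  refine ⟨{a | Sum.inl a ∈ P}, ⟨a₁, ha₁⟩, fun a ha b hb i => ?_, fun i => ?_⟩
  · refine (hbound a ha i).trans (Nat.add_le_add_right ?_ _)
    split_ifs
    · exact hm i b hb
    · exact Nat.zero_le _
  · by_cases hi : Sum.inr i ∈ P
    · right
      intro a ha
      have := hbound a ha i
      rwa [if_neg (by simpa [hC] using hi), zero_add] at this
    · exact Or.inl (hcol i hi)

/-- Any self-map of the standard simplex has, at every scale, a point none of whose coordinates
is decreased by the map, up to perturbation of the point. -/
lemma exists_almost_nondecreasing (g : stdSimplex ℝ ι → stdSimplex ℝ ι) {k : ℕ} (hk : 0 < k) :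
    ∃ x : stdSimplex ℝ ι, ∀ i, ∃ z : stdSimplex ℝ ι,
      dist x z ≤ Fintype.card ι / k ∧ x.1 i ≤ (g z).1 i + Fintype.card ι / k := by
  classical
  have hk' : (0 : ℝ) < k := Nat.cast_pos.2 hk
  let p : SimplexGrid ι k → stdSimplex ℝ ι := fun a =>
    ⟨fun i => (a.1 i : ℝ) / k, fun i => by positivity, by
      rw [← Finset.sum_div, ← Nat.cast_sum, (Finset.mem_piAntidiag.1 a.2).1, div_self hk'.ne']⟩
  have hlabel : ∀ x : stdSimplex ℝ ι, ∃ i, x.1 i ≤ (g x).1 i := by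
    intro x
    by_contra! h
    have := Finset.sum_lt_sum_of_nonempty Finset.univ_nonempty fun i _ => h i
    rw [x.2.2, (g x).2.2] at this
    exact lt_irrefl _ this
  choose c hc using hlabel
  obtain ⟨P, ⟨a, ha⟩, hdiam, hcol⟩ := exists_small_colorful k fun a => c (p a)
  have hd : ∀ b ∈ P, ∀ i, (p a).1 i ≤ (p b).1 i + Fintype.card ι / k := by
    intro b hb i
    simp only [p]
    rw [← add_div]
    gcongr
    exact_mod_cast hdiam a ha b hb i
  have hd' : ∀ b ∈ P, ∀ i, (p b).1 i ≤ (p a).1 i + Fintype.card ι / k := by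
    intro b hb i
    simp only [p]
    rw [← add_div]
    gcongr
    exact_mod_cast hdiam b hb a ha i
  refine ⟨p a, fun i => ?_⟩
  rcases hcol i with ⟨b, hb, hbi⟩ | h
  · refine ⟨p b, ?_, ?_⟩
    · rw [Subtype.dist_eq, dist_pi_le_iff (by positivity)]
      intro j
      rw [Real.dist_eq, abs_le]
      constructor <;> linarith [hd b hb j, hd' b hb j]
    · have h1 := hc (p b)
      rw [hbi] at h1
      linarith [hd b hb i]
  · refine ⟨p a, by rw [dist_self]; positivity, ?_⟩
    have h1 : (p a).1 i ≤ Fintype.card ι / k := by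
      simp only [p]
      gcongr
      exact_mod_cast h a ha
    linarith [(g (p a)).2.1 i]

/-- **Brouwer's fixed point theorem** for the standard simplex. -/
theorem exists_fixedPoint_stdSimplex {g : stdSimplex ℝ ι → stdSimplex ℝ ι} (hg : Continuous g) :
    ∃ x, g x = x := by
  have happrox : ∀ ε > 0, ∃ x, ∀ i, x.1 i ≤ (g x).1 i + ε := by
    intro ε hε
    obtain ⟨δ, hδ, hgδ⟩ := Metric.uniformContinuous_iff.1
      (CompactSpace.uniformContinuous_of_continuous hg) (ε / 2) (half_pos hε)
    obtain ⟨k, hk⟩ := exists_nat_gt (Fintype.card ι / min δ (ε / 2))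
    have hmin : 0 < min δ (ε / 2) := lt_min hδ (half_pos hε)
    have hk0 : (0 : ℝ) < k := lt_of_le_of_lt (by positivity) hk
    have hkm : Fintype.card ι / (k : ℝ) < min δ (ε / 2) := by
      rw [div_lt_iff₀ hmin] at hk
      rw [div_lt_iff₀ hk0]
      linarith
    obtain ⟨x, hx⟩ := exists_almost_nondecreasing g (Nat.cast_pos.1 hk0)
    refine ⟨x, fun i => ?_⟩
    obtain ⟨z, hxz, hz⟩ := hx i
    have h1 := hgδ (hxz.trans_lt (hkm.trans_le (min_le_left _ _)))
    have h2 := (dist_le_pi_dist (g x).1 (g z).1 i).trans_lt h1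
    rw [Real.dist_eq, abs_lt] at h2
    have h3 := hkm.trans_le (min_le_right _ _)
    linarith [h2.1]
  -- `F` is the total decrease; by compactness its infimum `0` is attained. There no coordinate
  -- decreases, and equal coordinate sums force equality.
  let F : stdSimplex ℝ ι → ℝ := fun x => ∑ i, max (x.1 i - (g x).1 i) 0
  have hF : Continuous F := by
    refine continuous_finsetSum _ fun i _ => ?_
    exact (((continuous_apply i).comp continuous_subtype_val).sub
      ((continuous_apply i).comp (continuous_subtype_val.comp hg))).max continuous_const
  obtain ⟨x₀, -⟩ := happrox 1 one_pos
  have : Nonempty (stdSimplex ℝ ι) := ⟨x₀⟩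
  obtain ⟨x, -, hx⟩ := isCompact_univ.exists_isMinOn Set.univ_nonempty hF.continuousOn
  have hcard : (0 : ℝ) < Fintype.card ι := Nat.cast_pos.2 Fintype.card_pos
  have hF0 : F x ≤ 0 := by
    refine le_of_forall_pos_le_add fun ε hε => ?_
    obtain ⟨y, hy⟩ := happrox (ε / Fintype.card ι) (by positivity)
    calc F x ≤ F y := hx (Set.mem_univ y)
      _ ≤ ∑ _i : ι, ε / Fintype.card ι := by
        refine Finset.sum_le_sum fun i _ => max_le ?_ (by positivity)
        linarith [hy i]
      _ = 0 + ε := by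
        rw [Finset.sum_const, Finset.card_univ, nsmul_eq_mul, zero_add]
        field_simp
  have hle : ∀ i ∈ Finset.univ, x.1 i ≤ (g x).1 i := by
    intro i hi
    have h1 := Finset.single_le_sum (f := fun i => max (x.1 i - (g x).1 i) 0)
      (fun j _ => le_max_right _ _) hi
    have h2 := (le_max_left (x.1 i - (g x).1 i) 0).trans (h1.trans hF0)
    linarith
  refine ⟨x, Subtype.ext (funext fun i => ?_)⟩
  exact (((Finset.sum_eq_sum_iff_of_le hle).1 (x.2.2.trans (g x).2.2.symm)) i
    (Finset.mem_univ i)).symm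

end Brouwer

/-! ### Schauder approximation and the net. -/

section ApproxFixedPoint

variable {X : Type u} [AddCommGroup X] [Module ℝ X]

/-- Schauder's approximation: if `f(C)` is covered by finitely many unit balls, centred in `C`,
of a continuous seminorm, then `f` moves some point of `C` by less than one. -/
lemma exists_seminorm_sub_lt_one_of_cover [TopologicalSpace X]
    [IsTopologicalAddGroup X] [ContinuousSMul ℝ X] {C : Set X} (hconv : Convex ℝ C)
    {Y : Set X} {f : C → Y} (hf : SeqContinuous f) {p : Seminorm ℝ X} (hp : Continuous p)
    {κ : Type*} [Fintype κ] [Nonempty κ] (c : κ → X) (hc : ∀ j, c j ∈ C)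
    (hcover : ∀ x, ∃ j, p ((f x : X) - c j) < 1) : ∃ x : C, p ((x : X) - f x) < 1 := by
  let h : stdSimplex ℝ κ → C := fun t =>
    ⟨∑ j, t.1 j • c j, hconv.sum_mem (fun j _ => t.2.1 j) t.2.2 fun j _ => hc j⟩
  have hh : Continuous h := by
    refine Continuous.subtype_mk (continuous_finsetSum _ fun j _ => ?_) _
    exact ((continuous_apply j).comp continuous_subtype_val).smul continuous_const
  have hfh : Continuous fun t => (f (h t) : X) := by
    have hseq : SeqContinuous (f ∘ h) := fun _ _ hu => hf (hh.seqContinuous hu)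
    exact continuous_subtype_val.comp hseq.continuous
  -- Schauder weights: `φ j` vanishes unless `c j` is within `p`-distance one of `f (h t)`.
  let φ : κ → stdSimplex ℝ κ → ℝ := fun j t => max (1 - p ((f (h t) : X) - c j)) 0
  have hφ : ∀ j, Continuous (φ j) := fun j =>
    (continuous_const.sub (hp.comp (hfh.sub continuous_const))).max continuous_const
  have hφ0 : ∀ j t, 0 ≤ φ j t := fun j t => le_max_right _ _
  have hpos : ∀ t, 0 < ∑ j, φ j t := by
    intro t
    obtain ⟨j, hj⟩ := hcover (h t)
    exact Finset.sum_pos' (fun j _ => hφ0 j t)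
      ⟨j, Finset.mem_univ j, lt_max_of_lt_left (sub_pos.2 hj)⟩
  let g : stdSimplex ℝ κ → stdSimplex ℝ κ := fun t =>
    ⟨fun j => φ j t / ∑ i, φ i t, fun j => div_nonneg (hφ0 j t) (hpos t).le, by
      rw [← Finset.sum_div, div_self (hpos t).ne']⟩
  have hg : Continuous g := by
    refine Continuous.subtype_mk (continuous_pi fun j => ?_) _
    exact (hφ j).div (continuous_finsetSum _ fun i _ => hφ i) fun t => (hpos t).ne'
  obtain ⟨t, ht⟩ := exists_fixedPoint_stdSimplex hg
  refine ⟨h t, ?_⟩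
  have hball : ∑ᶠ j, t.1 j • c j ∈ p.ball (f (h t) : X) 1 := by
    refine (p.convex_ball _ _).finsum_mem t.2.1
      (by rw [finsum_eq_sum_of_fintype]; exact t.2.2) fun j hj => ?_
    rw [Seminorm.mem_ball, map_sub_rev]
    by_contra hcon
    apply hj
    rw [← ht]
    change φ j t / _ = 0
    rw [show φ j t = 0 from max_eq_right (by linarith), zero_div]
  rw [finsum_eq_sum_of_fintype] at hball
  exact p.mem_ball.1 hball

variable [UniformSpace X] [IsUniformAddGroup X] [ContinuousSMul ℝ X]

/-- A sequentially continuous map from a convex set to its closure with totally bounded range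
moves some point by less than one, in any continuous seminorm. -/
lemma exists_seminorm_sub_lt_one {C : Set X} (hne : C.Nonempty) (hconv : Convex ℝ C)
    {f : C → closure C} (hf : SeqContinuous f)
    (htb : TotallyBounded (Set.range fun x : C => (f x : X))) {p : Seminorm ℝ X}
    (hp : Continuous p) : ∃ x : C, p ((x : X) - f x) < 1 := by
  have hball : ∀ y : X, {z | p (z - y) < 1 / 2} ∈ 𝓝 y := fun y =>
    (isOpen_lt (hp.comp (continuous_id.sub continuous_const)) continuous_const).mem_nhds
      (by simp)
  have hent : {q : X × X | p (q.1 - q.2) < 1 / 2} ∈ uniformity X := by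
    rw [uniformity_eq_comap_nhds_zero_swapped]
    exact ⟨{z | p (z - 0) < 1 / 2}, hball 0, fun q hq => by simpa using hq⟩
  obtain ⟨t, hts, htfin, hcover⟩ := htb.exists_subset hent
  -- The ball centres lie only in `closure C`; moving them into `C` uses the other half of the
  -- radius.
  have hc : ∀ y : t, ∃ c ∈ C, p (c - y) < 1 / 2 := by
    rintro ⟨y, hy⟩
    obtain ⟨x, rfl⟩ := hts hy
    obtain ⟨c, hc, hcC⟩ := mem_closure_iff_nhds.1 (f x).2 _ (hball _)
    exact ⟨c, hcC, hc⟩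
  choose c hcC hc using hc
  have hcov : ∀ x, ∃ y : t, p ((f x : X) - c y) < 1 := by
    intro x
    obtain ⟨y, hy, hxy⟩ := Set.mem_iUnion₂.1 (hcover ⟨x, rfl⟩)
    refine ⟨⟨y, hy⟩, ?_⟩
    have h1 : p ((f x : X) - y) < 1 / 2 := hxy
    have h2 := hc ⟨y, hy⟩
    rw [map_sub_rev] at h2
    have h3 := map_add_le_add p ((f x : X) - y) (y - c ⟨y, hy⟩)
    rw [sub_add_sub_cancel] at h3
    linarith
  have := htfin.fintype
  obtain ⟨x₀, hx₀⟩ := hne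
  have : Nonempty t := ⟨(hcov ⟨x₀, hx₀⟩).choose⟩
  exact exists_seminorm_sub_lt_one_of_cover hconv hf hp c hcC hcov

end ApproxFixedPoint

theorem theorem1 {X : Type u} [AddCommGroup X] [Module ℝ X]
    [UniformSpace X] [IsUniformAddGroup X] [ContinuousSMul ℝ X] [LocallyConvexSpace ℝ X]
    (C : Set X) (hne : C.Nonempty) (hconv : Convex ℝ C)
    (f : C → closure C) (hf : SeqContinuous f)
    (htb : TotallyBounded (Set.range fun x : C => (f x : X))) :
    HasApproxFixedPointNet f ∧
      (0 : X) ∈ closure {y : X | ∃ x : C, y = (x : X) - (f x : X)} := by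
  have key : ∀ U : {U : Set X // U ∈ 𝓝 (0 : X)}, ∃ x : C, (x : X) - f x ∈ U.1 := by
    rintro ⟨U, hU⟩
    obtain ⟨s, hs, hsU⟩ := (nhds_hasBasis_absConvex_open ℝ X).mem_iff.1 hU
    -- An absolutely convex open set is the unit ball of its gauge.
    let S : AbsConvexOpenSets ℝ X := ⟨s, hs⟩
    obtain ⟨x, hx⟩ := exists_seminorm_sub_lt_one hne hconv hf htb
      ((with_gaugeSeminormFamily (𝕜 := ℝ) (E := X)).continuous_seminorm S)
    exact ⟨x, hsU ((gaugeSeminormFamily_ball S).subset ((Seminorm.mem_ball_zero _).2 hx))⟩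
  choose x hx using key
  -- The net is indexed by neighbourhoods of `0` under reverse inclusion.
  refine ⟨⟨{U : Set X // U ∈ 𝓝 (0 : X)}ᵒᵈ, inferInstance, ⟨fun U V => ?_⟩,
    ⟨OrderDual.toDual ⟨Set.univ, univ_mem⟩⟩, fun U => x (OrderDual.ofDual U), ?_⟩, ?_⟩
  · exact ⟨OrderDual.toDual ⟨U.ofDual.1 ∩ V.ofDual.1, inter_mem U.ofDual.2 V.ofDual.2⟩,
      Set.inter_subset_left, Set.inter_subset_right⟩
  · refine tendsto_def.2 fun U hU => ?_
    filter_upwards [eventually_ge_atTop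
      (OrderDual.toDual (⟨U, hU⟩ : {U : Set X // U ∈ 𝓝 (0 : X)}))] with V hV
    have hVU : V.ofDual.1 ⊆ U := hV
    exact hVU (hx V.ofDual)
  · exact mem_closure_iff_nhds.2 fun U hU => ⟨_, hx ⟨U, hU⟩, _, rfl⟩
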